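/- Let $T:[0,1)\to[0,1)$ be the Engel series map, $T(0)=0$ and $T(x)=x\lceil 1/x\rceil-1$ for $x\in(0,1)$. For $x\in(0,1)$ the Engel digits of $x$ are $d_n(x)=\lceil 1/T^{n-1}(x)\rceil$, defined for all $n\ge 1$ with $T^{n-1}(x)\neq 0$; this is a finite sequence if $T^k(x)=0$ for some $k$ (which happens exactly when $x$ is rational), and an infinite one otherwise. Let $$\lambda(x)=\inf\Big\{s\ge 0:\ \sum_{n} d_n(x)^{-s}<\infty\Big\}\in[0,\infty]$$ be the exponent of convergence of the digit sequence (the sum is over all $n$ for which $d_n(x)$ is defined, and $\inf\emptyset=\infty$), and let $$D(x)=\liminf_{n\to\infty}\frac{\log d_n(x)}{\log n}\in[0,\infty]$$ if $x$ is irrational, and $D(x)=\infty$ if $x$ is rational. Let $\dim_{\rm H}$ denote the Hausdorff dimension. Then: (1) For every $\alpha\in[0,\infty]$, $$\dim_{\rm H}\{x\in(0,1):\lambda(x)=\alpha\}=\dim_{\rm H}\{x\in(0,1):\lambda(x)\ge\alpha\}=\begin{cases}1-\alpha, & 0\le\alpha\le 1,\\ 0, & 1<\alpha\le\infty.\end{cases}$$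 (2) For every $\alpha\in[0,\infty]$, $$\dim_{\rm H}\{x\in(0,1):D(x)=\alpha\}=\dim_{\rm H}\{x\in(0,1):D(x)\le\alpha\}=\begin{cases}0, & 0\le\alpha<1,\\ \dfrac{\alpha-1}{\alpha}, & 1\le\alpha\le\infty,\end{cases}$$ where $\frac{\alpha-1}{\alpha}$ is read as $1$ for $\alpha=\infty$. -/

import Mathlib

open scoped NNReal ENNReal

/-- The Engel series map `T`: `T 0 = 0` and `T x = x * ⌈1 / x⌉ - 1` for `x ≠ 0`
(only its values on `[0, 1)`, which it maps to itself, matter). -/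
noncomputable def engelMap (x : ℝ) : ℝ :=
  if x = 0 then 0 else x * (⌈1 / x⌉ : ℝ) - 1

/-- `engelDigit x k` is the Engel digit `d_{k+1}(x) = ⌈1 / T^k x⌉`, so `k = 0` gives the first
digit. It is a digit of the expansion of `x ∈ (0, 1)` exactly when `T^k x ≠ 0`. -/
noncomputable def engelDigit (x : ℝ) (k : ℕ) : ℕ :=
  ⌈1 / (engelMap^[k] x)⌉₊

/-- The exponent of convergence of a family `a` of positive integers: the infimum in `[0, ∞]` of
the real numbers `s ≥ 0` for which `∑ i, (a i) ^ (-s)` converges (it is `∞` if there is none). -/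
noncomputable def convergenceExponent {ι : Type*} (a : ι → ℕ) : ℝ≥0∞ :=
  ⨅ (s : ℝ≥0) (_ : Summable fun i => (a i : ℝ) ^ (-(s : ℝ))), (s : ℝ≥0∞)

/-- `λ(x)`: the exponent of convergence of the (finite or infinite) sequence of Engel digits
of `x`. The index type consists of those `k` for which the digit `d_{k+1}(x)` exists. -/
noncomputable def engelExponent (x : ℝ) : ℝ≥0∞ :=
  convergenceExponent fun k : {k : ℕ // engelMap^[k] x ≠ 0} => engelDigit x k

open Classical in
/-- `D(x) = liminf_{n → ∞} log d_n(x) / log n`, with `n = k + 1`, when the expansion of `x` is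
infinite; `D(x) = ∞` when it is finite, in accordance with `λ(x) = 0 = 1 / D(x)` there. The
quotients are nonnegative, so `ENNReal.ofReal` does not change them. -/
noncomputable def engelLogRate (x : ℝ) : ℝ≥0∞ :=
  if ∃ k : ℕ, engelMap^[k] x = 0 then ⊤
  else Filter.liminf
    (fun k : ℕ => ENNReal.ofReal (Real.log (engelDigit x k : ℝ) / Real.log ((k : ℝ) + 1)))
    Filter.atTop

open Set Filter Topology MeasureTheory

/-! Digits are nondecreasing because `engelMap x < x`; hence convergence of `∑ d_n ^ (-s)` is
governed by the growth exponent of `d_n`, and `λ = 1 / D` (`engelExponent_eq_inv`). Part (1) is then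
part (2) under inversion, and both values of (2) are `1 - 1/α` with truncated subtraction.

Lower bound: let the `n`-th digit range freely over `[a n, a (n + 1))`. Cantor series digits
parametrise these points by `[0, 1)`. Parameters agreeing in `n` digits differ by at most the
inverse product of the `n` block lengths, while Engel sums first differing at `n` are at least `1 /
(d 0 ⋯ d (n + 1))` apart. For `a n ≈ n ^ β` the block lengths are of order `n ^ (β - 1)`, so the
inverse of the parametrisation is Hölder of every exponent `s < (β - 1) / β`
(`le_dimH_engelDigit_blocks`). For `α = ∞` dyadic blocks give every `s < 1`.

Upper bound: if `D ≤ β < τ`, then `d_n < n ^ τ` infinitely often, and by monotonicity all of the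
first `n` digits lie in `[2, n ^ τ]`. Covering by cylinders costs at most `∑ (d_1 ⋯ d_n) ^ (-s)`,
which a generating function in `t > 1` bounds by `t ^ (-n) * exp (K * n ^ (τ * (1 - s)))`. This is
summable when `τ * (1 - s) < 1`, and Borel–Cantelli applies
(`hausdorffMeasure_frequently_engelDigit_lt`). -/

/-! ### The Engel map and monotonicity of the digits -/

lemma engelMap_zero : engelMap 0 = 0 := by simp [engelMap]

lemma ceil_inv_bounds {x : ℝ} (hx : x ∈ Ioo (0 : ℝ) 1) :
    2 ≤ ⌈1 / x⌉₊ ∧ 1 ≤ x * ⌈1 / x⌉₊ ∧ x * (⌈1 / x⌉₊ - 1) < 1 := by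
  have h1 : 1 < 1 / x := by rw [lt_div_iff₀ hx.1]; linarith [hx.2]
  have h2 : 1 < ⌈1 / x⌉₊ := by rw [Nat.lt_ceil]; exact_mod_cast h1
  have h3 := Nat.le_ceil (1 / x)
  have h4 := Nat.ceil_lt_add_one (a := 1 / x) (by linarith)
  have hxx : x * (1 / x) = 1 := by field_simp [hx.1.ne']
  refine ⟨h2, ?_, ?_⟩
  · exact hxx.symm.trans_le (mul_le_mul_of_nonneg_left h3 hx.1.le)
  · calc x * (⌈1 / x⌉₊ - 1) < x * (1 / x) := mul_lt_mul_of_pos_left (by linarith) hx.1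
      _ = 1 := hxx

lemma engelMap_eq {x : ℝ} (hx : x ∈ Ioo (0 : ℝ) 1) : engelMap x = x * ⌈1 / x⌉₊ - 1 := by
  have h : (0 : ℝ) ≤ 1 / x := by have := hx.1; positivity
  rw [engelMap, if_neg hx.1.ne', ← natCast_ceil_eq_intCast_ceil h]

lemma engelMap_nonneg {x : ℝ} (hx : x ∈ Ioo (0 : ℝ) 1) : 0 ≤ engelMap x := by
  rw [engelMap_eq hx]; linarith [(ceil_inv_bounds hx).2.1]

lemma engelMap_lt {x : ℝ} (hx : x ∈ Ioo (0 : ℝ) 1) : engelMap x < x := by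
  rw [engelMap_eq hx]; linarith [(ceil_inv_bounds hx).2.2]

lemma engelMap_mem_Ico {x : ℝ} (hx : x ∈ Ico (0 : ℝ) 1) : engelMap x ∈ Ico (0 : ℝ) 1 := by
  rcases hx.1.eq_or_lt with rfl | h
  · simp [engelMap_zero]
  · exact ⟨engelMap_nonneg ⟨h, hx.2⟩, (engelMap_lt ⟨h, hx.2⟩).trans hx.2⟩

lemma engelMap_iterate_mem_Ico {x : ℝ} (hx : x ∈ Ico (0 : ℝ) 1) (k : ℕ) :
    engelMap^[k] x ∈ Ico (0 : ℝ) 1 := by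
  induction k with
  | zero => simpa using hx
  | succ k ih => rw [Function.iterate_succ_apply']; exact engelMap_mem_Ico ih

lemma engelMap_iterate_mem_Ioo {x : ℝ} (hx : x ∈ Ico (0 : ℝ) 1) {k : ℕ}
    (hk : engelMap^[k] x ≠ 0) : engelMap^[k] x ∈ Ioo (0 : ℝ) 1 :=
  ⟨(engelMap_iterate_mem_Ico hx k).1.lt_of_ne' hk, (engelMap_iterate_mem_Ico hx k).2⟩

lemma engelMap_iterate_eq_zero_of_le {x : ℝ} {k l : ℕ} (hkl : k ≤ l)
    (hk : engelMap^[k] x = 0) : engelMap^[l] x = 0 := by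
  induction l, hkl using Nat.le_induction with
  | base => exact hk
  | succ l _ ih => rw [Function.iterate_succ_apply', ih, engelMap_zero]

lemma engelDigit_zero (x : ℝ) : engelDigit x 0 = ⌈1 / x⌉₊ := rfl

lemma two_le_engelDigit {x : ℝ} (hx : x ∈ Ico (0 : ℝ) 1) {k : ℕ} (hk : engelMap^[k] x ≠ 0) :
    2 ≤ engelDigit x k :=
  (ceil_inv_bounds (engelMap_iterate_mem_Ioo hx hk)).1

lemma engelDigit_le_of_le {x : ℝ} (hx : x ∈ Ico (0 : ℝ) 1) {k l : ℕ} (hkl : k ≤ l)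
    (hl : engelMap^[l] x ≠ 0) : engelDigit x k ≤ engelDigit x l := by
  induction l, hkl using Nat.le_induction with
  | base => exact le_rfl
  | succ l _ ih =>
    have hl' : engelMap^[l] x ≠ 0 := fun h =>
      hl (engelMap_iterate_eq_zero_of_le l.le_succ h)
    refine (ih hl').trans (Nat.ceil_mono (one_div_le_one_div_of_le ?_ ?_))
    · exact (engelMap_iterate_mem_Ioo hx hl).1
    · rw [Function.iterate_succ_apply']
      exact (engelMap_lt (engelMap_iterate_mem_Ioo hx hl')).le

/-! ### Engel series with prescribed digits -/

/-- The sum `∑ 1 / (d 0 ⋯ d n)` of the Engel series with digits `d`. -/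
noncomputable def engelSum (d : ℕ → ℕ) : ℝ :=
  ∑' n, ∏ j ∈ Finset.range (n + 1), ((d j : ℝ))⁻¹

lemma engelSum_term_le {d : ℕ → ℕ} (hd : StrictMono d) (h0 : 2 ≤ d 0) (n : ℕ) :
    ∏ j ∈ Finset.range (n + 1), ((d j : ℝ))⁻¹ ≤ (d 0 : ℝ)⁻¹ * (d 0 : ℝ)⁻¹ ^ n := by
  rw [← pow_succ', ← Finset.card_range (n + 1), ← Finset.prod_const, Finset.card_range]
  refine Finset.prod_le_prod (fun _ _ => by positivity) fun j _ => ?_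
  have : (d 0 : ℝ) ≤ d j := by exact_mod_cast hd.monotone (Nat.zero_le j)
  have : (2 : ℝ) ≤ d 0 := by exact_mod_cast h0
  gcongr

lemma engelSum_summable {d : ℕ → ℕ} (hd : StrictMono d) (h0 : 2 ≤ d 0) :
    Summable fun n => ∏ j ∈ Finset.range (n + 1), ((d j : ℝ))⁻¹ := by
  have : (2 : ℝ) ≤ d 0 := by exact_mod_cast h0
  refine Summable.of_nonneg_of_le (fun _ => by positivity) (engelSum_term_le hd h0)
    ((summable_geometric_of_lt_one (by positivity) ?_).mul_left _)
  exact inv_lt_one_of_one_lt₀ (by linarith)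

lemma engelSum_le {d : ℕ → ℕ} (hd : StrictMono d) (h0 : 2 ≤ d 0) :
    engelSum d ≤ 1 / (d 0 - 1) := by
  have h2 : (2 : ℝ) ≤ d 0 := by exact_mod_cast h0
  have h1 : (d 0 : ℝ)⁻¹ < 1 := inv_lt_one_of_one_lt₀ (by linarith)
  refine ((engelSum_summable hd h0).tsum_le_tsum (engelSum_term_le hd h0)
    ((summable_geometric_of_lt_one (by positivity) h1).mul_left _)).trans_eq ?_
  rw [tsum_mul_left, tsum_geometric_of_lt_one (by positivity) h1]
  have : (d 0 : ℝ) - 1 ≠ 0 := by linarith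
  field_simp

lemma engelSum_eq {d : ℕ → ℕ} (hd : StrictMono d) (h0 : 2 ≤ d 0) :
    engelSum d = (1 + engelSum fun k => d (k + 1)) / d 0 := by
  rw [engelSum, (engelSum_summable hd h0).tsum_eq_zero_add, engelSum, add_div, ← tsum_div_const]
  congr 1
  · simp
  · congr 1 with n
    rw [Finset.prod_range_succ', div_eq_mul_inv]

lemma strictMono_shift {d : ℕ → ℕ} (hd : StrictMono d) : StrictMono fun k => d (k + 1) :=
  fun _ _ h => hd (by omega)

lemma engelSum_nonneg (d : ℕ → ℕ) : 0 ≤ engelSum d := tsum_nonneg fun _ => by positivity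

lemma inv_le_engelSum {d : ℕ → ℕ} (hd : StrictMono d) (h0 : 2 ≤ d 0) :
    1 / (d 0 : ℝ) ≤ engelSum d := by
  rw [engelSum_eq hd h0]
  gcongr
  linarith [engelSum_nonneg fun k => d (k + 1)]

/-- Since `d 1 ≥ d 0 + 1`, the tail is at most `1 / d 0`, and `(d 0 + 1) * (d 0 - 1) < d 0 ^ 2`.
Strictness matters: a constant sequence attains `1 / (d 0 - 1)`, where the ceiling no longer returns
`d 0`. -/
lemma engelSum_lt {d : ℕ → ℕ} (hd : StrictMono d) (h0 : 2 ≤ d 0) :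
    engelSum d < 1 / (d 0 - 1) := by
  have h2 : (2 : ℝ) ≤ d 0 := by exact_mod_cast h0
  have h01 : (d 0 : ℝ) + 1 ≤ d 1 := by exact_mod_cast hd (Nat.zero_lt_one)
  have h1 : 2 ≤ d 1 := h0.trans (hd.monotone (Nat.zero_le 1))
  have h3 : engelSum (fun k => d (k + 1)) ≤ 1 / (d 0 : ℝ) :=
    (engelSum_le (strictMono_shift hd) h1).trans
      (one_div_le_one_div_of_le (by linarith) (by simp only [zero_add]; linarith))
  rw [engelSum_eq hd h0, div_lt_div_iff₀ (by linarith) (by linarith)]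
  have : (1 + 1 / (d 0 : ℝ)) * (d 0 - 1) < 1 * d 0 := by
    have : 1 / (d 0 : ℝ) * d 0 = 1 := by field_simp
    have : 0 < 1 / (d 0 : ℝ) := by positivity
    linarith
  have : (1 + engelSum fun k => d (k + 1)) * (d 0 - 1) ≤ (1 + 1 / (d 0 : ℝ)) * (d 0 - 1) := by
    gcongr; linarith
  linarith

lemma engelSum_mem {d : ℕ → ℕ} (hd : StrictMono d) (h0 : 2 ≤ d 0) :
    engelSum d ∈ Ioo (0 : ℝ) 1 := by
  have h2 : (2 : ℝ) ≤ d 0 := by exact_mod_cast h0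
  refine ⟨lt_of_lt_of_le (by positivity) (inv_le_engelSum hd h0), (engelSum_lt hd h0).trans_le ?_⟩
  rw [div_le_one (by linarith)]; linarith

lemma ceil_inv_engelSum {d : ℕ → ℕ} (hd : StrictMono d) (h0 : 2 ≤ d 0) :
    ⌈1 / engelSum d⌉₊ = d 0 := by
  have h2 : (2 : ℝ) ≤ d 0 := by exact_mod_cast h0
  have hpos := (engelSum_mem hd h0).1
  rw [Nat.ceil_eq_iff (by omega)]
  constructor
  · rw [lt_div_iff₀ hpos, Nat.cast_sub (by omega), Nat.cast_one]
    have := engelSum_lt hd h0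
    rw [lt_div_iff₀ (by linarith)] at this
    linarith
  · rw [div_le_iff₀ hpos]
    have := inv_le_engelSum hd h0
    rw [div_le_iff₀ (by linarith)] at this
    linarith

lemma engelMap_engelSum {d : ℕ → ℕ} (hd : StrictMono d) (h0 : 2 ≤ d 0) :
    engelMap (engelSum d) = engelSum fun k => d (k + 1) := by
  have h2 : (2 : ℝ) ≤ d 0 := by exact_mod_cast h0
  rw [engelMap_eq (engelSum_mem hd h0), ceil_inv_engelSum hd h0, engelSum_eq hd h0]
  field_simp
  ring

lemma engelMap_iterate_engelSum {d : ℕ → ℕ} (hd : StrictMono d) (h0 : 2 ≤ d 0) (n : ℕ) :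
    engelMap^[n] (engelSum d) = engelSum fun k => d (k + n) := by
  induction n generalizing d with
  | zero => rfl
  | succ n ih =>
    rw [Function.iterate_succ_apply, engelMap_engelSum hd h0,
      ih (strictMono_shift hd) (h0.trans (hd.monotone (Nat.zero_le _)))]
    rfl

lemma strictMono_shift_add {d : ℕ → ℕ} (hd : StrictMono d) (n : ℕ) :
    StrictMono fun k => d (k + n) :=
  fun _ _ h => hd (by omega)

lemma engelMap_iterate_engelSum_ne_zero {d : ℕ → ℕ} (hd : StrictMono d) (h0 : 2 ≤ d 0) (n : ℕ) :
    engelMap^[n] (engelSum d) ≠ 0 := by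
  rw [engelMap_iterate_engelSum hd h0]
  exact (engelSum_mem (strictMono_shift_add hd n) (h0.trans (hd.monotone (Nat.zero_le _)))).1.ne'

lemma engelDigit_engelSum {d : ℕ → ℕ} (hd : StrictMono d) (h0 : 2 ≤ d 0) (n : ℕ) :
    engelDigit (engelSum d) n = d n := by
  rw [engelDigit, engelMap_iterate_engelSum hd h0, ceil_inv_engelSum (strictMono_shift_add hd n)
    (h0.trans (hd.monotone (Nat.zero_le _))), zero_add]

/-- Engel sums whose digits first differ in position `n` differ by at least
`1 / (d 0 ⋯ d (n + 1))`. -/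
lemma prod_le_engelSum_sub {d e : ℕ → ℕ} (hd : StrictMono d) (he : StrictMono e) (h0 : 2 ≤ d 0)
    (h0' : 2 ≤ e 0) (n : ℕ) (heq : ∀ j < n, d j = e j) (hlt : d n < e n) :
    ∏ j ∈ Finset.range (n + 2), ((d j : ℝ))⁻¹ ≤ engelSum d - engelSum e := by
  induction n generalizing d e with
  | zero =>
    have h2 : (2 : ℝ) ≤ d 0 := by exact_mod_cast h0
    have h3 : (d 0 : ℝ) + 1 ≤ e 0 := by exact_mod_cast hlt
    -- All of `engelSum e` fits below the leading term `1 / d 0` of `engelSum d`; the gap is at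
    -- least the rest of `engelSum d`, hence at least its second term.
    have h4 : engelSum e ≤ 1 / (d 0 : ℝ) :=
      (engelSum_le he h0').trans (one_div_le_one_div_of_le (by linarith) (by linarith))
    have h5 := inv_le_engelSum (strictMono_shift hd) (h0.trans (hd.monotone (Nat.zero_le 1)))
    rw [engelSum_eq hd h0, Finset.prod_range_succ, Finset.prod_range_one]
    simp only [zero_add] at h5 ⊢
    have : (d 0 : ℝ)⁻¹ * (d 1 : ℝ)⁻¹ ≤ (engelSum fun k => d (k + 1)) / d 0 := by
      rw [div_eq_inv_mul]
      rw [one_div] at h5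
      gcongr
    rw [add_div]
    linarith
  | succ n ih =>
    have h := ih (strictMono_shift hd) (strictMono_shift he)
      (h0.trans (hd.monotone (Nat.zero_le 1))) (h0'.trans (he.monotone (Nat.zero_le 1)))
      (fun j hj => heq (j + 1) (by omega)) hlt
    rw [engelSum_eq hd h0, engelSum_eq he h0', ← heq 0 (by omega), ← sub_div,
      Finset.prod_range_succ', ← div_eq_mul_inv]
    gcongr
    linarith

/-! ### Lower bound: coding digit blocks by Cantor series -/

/-- A set parametrised by `[0, 1)` through a map with a Hölder continuous inverse of exponent `s`
has Hausdorff dimension at least `s`. -/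
lemma le_dimH_image_Ico {g : ℝ → ℝ} {s : ℝ≥0} (hs : 0 < s) (C : ℝ≥0)
    (hg : ∀ y ∈ Ico (0 : ℝ) 1, ∀ z ∈ Ico (0 : ℝ) 1, |y - z| ≤ C * |g y - g z| ^ (s : ℝ)) :
    (s : ℝ≥0∞) ≤ dimH (g '' Ico 0 1) := by
  have hinj : InjOn g (Ico 0 1) := by
    intro y hy z hz hyz
    have := hg y hy z hz
    rw [hyz, sub_self, abs_zero, Real.zero_rpow (by exact_mod_cast hs.ne'), mul_zero] at this
    exact sub_eq_zero.1 (abs_nonpos_iff.1 this)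
  have hf : HolderOnWith C s (Function.invFunOn g (Ico 0 1)) (g '' Ico 0 1) := by
    rintro _ ⟨y, hy, rfl⟩ _ ⟨z, hz, rfl⟩
    rw [hinj.leftInvOn_invFunOn hy, hinj.leftInvOn_invFunOn hz, edist_dist, edist_dist,
      Real.dist_eq, Real.dist_eq, ENNReal.ofReal_rpow_of_nonneg (abs_nonneg _) s.coe_nonneg,
      ← ENNReal.ofReal_coe_nnreal, ← ENNReal.ofReal_mul C.coe_nonneg]
    exact ENNReal.ofReal_le_ofReal (hg y hy z hz)
  have h1 := hf.dimH_image_le hs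
  rw [hinj.leftInvOn_invFunOn.image_image] at h1
  have h2 : dimH (Ico (0 : ℝ) 1) = 1 := by
    have := Real.dimH_of_nonempty_interior (E := ℝ) (s := Ico (0 : ℝ) 1) (by simp)
    simpa using this
  rw [h2, ENNReal.le_div_iff_mul_le (by simp [hs.ne']) (by simp), one_mul] at h1
  exact h1

/-- The `n`-th digit of `y` in the Cantor series with base factors `a (n + 1) - a n`, shifted
by `a n`. -/
noncomputable def cantorDigit (a : ℕ → ℕ) (y : ℝ) (n : ℕ) : ℕ :=
  a n + (⌊(∏ j ∈ Finset.range (n + 1), (a (j + 1) - a j) : ℕ) * y⌋₊ -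
    (a (n + 1) - a n) * ⌊(∏ j ∈ Finset.range n, (a (j + 1) - a j) : ℕ) * y⌋₊)

/-- This makes the truncated subtraction in `cantorDigit` exact and keeps the digit below the base.
-/
lemma mul_floor_bounds (m P : ℕ) (hm : 0 < m) {y : ℝ} (hy : 0 ≤ y) :
    m * ⌊(P : ℝ) * y⌋₊ ≤ ⌊((P * m : ℕ) : ℝ) * y⌋₊ ∧
      ⌊((P * m : ℕ) : ℝ) * y⌋₊ < m * ⌊(P : ℝ) * y⌋₊ + m := by
  have hm' : (0 : ℝ) < m := by exact_mod_cast hm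
  have h1 : (⌊(P : ℝ) * y⌋₊ : ℝ) ≤ P * y := Nat.floor_le (by positivity)
  have h2 := Nat.lt_floor_add_one ((P : ℝ) * y)
  have e : (((P * m : ℕ) : ℝ) * y) = m * (P * y) := by push_cast; ring
  constructor
  · refine Nat.le_floor ?_
    rw [e]; push_cast; gcongr
  · rw [Nat.floor_lt (by positivity), e]
    push_cast
    calc (m : ℝ) * (P * y) < m * (⌊(P : ℝ) * y⌋₊ + 1) := by gcongr
      _ = _ := by ring

lemma cantorDigit_bounds {a : ℕ → ℕ} (ha : StrictMono a) {y : ℝ} (hy : 0 ≤ y) (n : ℕ) :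
    a n ≤ cantorDigit a y n ∧ cantorDigit a y n < a (n + 1) := by
  have hlt := ha (Nat.lt_succ_self n)
  have := mul_floor_bounds (a (n + 1) - a n) (∏ j ∈ Finset.range n, (a (j + 1) - a j))
    (by simp only [Nat.succ_eq_add_one] at hlt; omega) hy
  simp only [cantorDigit, Finset.prod_range_succ]
  simp only [Nat.succ_eq_add_one] at hlt
  omega

lemma cantorDigit_strictMono {a : ℕ → ℕ} (ha : StrictMono a) {y : ℝ} (hy : 0 ≤ y) :
    StrictMono (cantorDigit a y) :=
  strictMono_nat_of_lt_succ fun n =>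
    (cantorDigit_bounds ha hy n).2.trans_le (cantorDigit_bounds ha hy (n + 1)).1

lemma floor_eq_of_cantorDigit_eq {a : ℕ → ℕ} (ha : StrictMono a) {y z : ℝ} (hy : y ∈ Ico (0 : ℝ) 1)
    (hz : z ∈ Ico (0 : ℝ) 1) (n : ℕ) (h : ∀ j < n, cantorDigit a y j = cantorDigit a z j) :
    ⌊(∏ j ∈ Finset.range n, (a (j + 1) - a j) : ℕ) * y⌋₊ =
      ⌊(∏ j ∈ Finset.range n, (a (j + 1) - a j) : ℕ) * z⌋₊ := by
  induction n with
  | zero => simp [Nat.floor_eq_zero.2 hy.2, Nat.floor_eq_zero.2 hz.2]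
  | succ n ih =>
    have ih := ih fun j hj => h j (by omega)
    have hn := h n (by omega)
    have hlt := ha (Nat.lt_succ_self n)
    simp only [Nat.succ_eq_add_one] at hlt
    have h1 := mul_floor_bounds (a (n + 1) - a n) (∏ j ∈ Finset.range n, (a (j + 1) - a j))
      (by omega) hy.1
    have h2 := mul_floor_bounds (a (n + 1) - a n) (∏ j ∈ Finset.range n, (a (j + 1) - a j))
      (by omega) hz.1
    simp only [cantorDigit, Finset.prod_range_succ, ih] at *
    omega

lemma abs_sub_le_of_cantorDigit_eq {a : ℕ → ℕ} (ha : StrictMono a) {y z : ℝ}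
    (hy : y ∈ Ico (0 : ℝ) 1) (hz : z ∈ Ico (0 : ℝ) 1) (n : ℕ)
    (h : ∀ j < n, cantorDigit a y j = cantorDigit a z j) :
    |y - z| ≤ ((∏ j ∈ Finset.range n, (a (j + 1) - a j) : ℕ) : ℝ)⁻¹ := by
  have hfl := floor_eq_of_cantorDigit_eq ha hy hz n h
  have hP : (0 : ℝ) < ((∏ j ∈ Finset.range n, (a (j + 1) - a j) : ℕ) : ℝ) := by
    exact_mod_cast Finset.prod_pos fun j _ => Nat.sub_pos_of_lt (ha (Nat.lt_succ_self j))
  set P : ℝ := ((∏ j ∈ Finset.range n, (a (j + 1) - a j) : ℕ) : ℝ)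
  have h1 := Nat.floor_le (mul_nonneg hP.le hy.1)
  have h2 := Nat.floor_le (mul_nonneg hP.le hz.1)
  have h3 := Nat.lt_floor_add_one (P * y)
  have h4 := Nat.lt_floor_add_one (P * z)
  rw [hfl] at h1 h3
  rw [← one_div, le_div_iff₀' hP, ← abs_of_pos hP, ← abs_mul, abs_le]
  constructor <;> linarith

/-- The hypothesis says that the quotient of the two sides eventually does not increase, so it is
bounded. The numerator has two more factors than the denominator because the separation of Engel
sums involves the digits up to index `n + 1`, with `d j < a (j + 1)`; hence `a (n + 3)`. -/
lemma exists_prod_rpow_le {a : ℕ → ℕ} (ha : StrictMono a) {s : ℝ}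
    (h : ∀ᶠ n in atTop, (a (n + 3) : ℝ) ^ s ≤ (a (n + 1) - a n : ℕ)) :
    ∃ C : ℝ≥0, ∀ n, (∏ j ∈ Finset.range (n + 2), (a (j + 1) : ℝ)) ^ s ≤
      C * (∏ j ∈ Finset.range n, (a (j + 1) - a j) : ℕ) := by
  obtain ⟨N, hN⟩ := eventually_atTop.1 h
  have hpos : ∀ n, (0 : ℝ) < (∏ j ∈ Finset.range n, (a (j + 1) - a j) : ℕ) := fun n => by
    exact_mod_cast Finset.prod_pos fun j _ => Nat.sub_pos_of_lt (ha (Nat.lt_succ_self j))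
  set R : ℕ → ℝ := fun n => (∏ j ∈ Finset.range (n + 2), (a (j + 1) : ℝ)) ^ s /
      (∏ j ∈ Finset.range n, (a (j + 1) - a j) : ℕ) with hR
  have hR0 : ∀ n, 0 ≤ R n := fun n => by simp only [hR]; positivity
  have hstep : ∀ n, N ≤ n → R (n + 1) ≤ R n := fun n hn => by
    simp only [hR]
    rw [Finset.prod_range_succ _ (n + 2), Finset.prod_range_succ _ n, Nat.cast_mul,
      Real.mul_rpow (by positivity) (by positivity), mul_div_mul_comm]
    refine mul_le_of_le_one_right (by have := hpos n; positivity) ?_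
    exact div_le_one_of_le₀ (hN n hn) (by positivity)
  have hbd : ∀ n, R n ≤ ∑ k ∈ Finset.range (N + 1), R k := fun n => by
    rcases le_total n N with hn | hn
    · exact Finset.single_le_sum (f := R) (fun k _ => hR0 k) (Finset.mem_range.2 (by omega))
    · induction n, hn using Nat.le_induction with
      | base =>
        exact Finset.single_le_sum (f := R) (fun k _ => hR0 k) (Finset.mem_range.2 (by omega))
      | succ n hn ih => exact (hstep n hn).trans ih
  refine ⟨⟨_, Finset.sum_nonneg fun k (_ : k ∈ Finset.range (N + 1)) => hR0 k⟩, fun n => ?_⟩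
  rw [← div_le_iff₀ (hpos n)]
  exact hbd n

/-- Lower bound for the dimension of the set of Engel series whose digits lie in consecutive
blocks `[a n, a (n + 1))`. -/
lemma le_dimH_engelDigit_blocks {a : ℕ → ℕ} (ha : StrictMono a) (h0 : 2 ≤ a 0) {s : ℝ≥0}
    (hs : 0 < s) (h : ∀ᶠ n in atTop, (a (n + 3) : ℝ) ^ (s : ℝ) ≤ (a (n + 1) - a n : ℕ)) :
    (s : ℝ≥0∞) ≤ dimH {x : ℝ | x ∈ Ioo (0 : ℝ) 1 ∧ ∀ k, engelMap^[k] x ≠ 0 ∧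
      a k ≤ engelDigit x k ∧ engelDigit x k < a (k + 1)} := by
  obtain ⟨C, hC⟩ := exists_prod_rpow_le ha h
  have hs' : (0 : ℝ) < s := hs
  have hpos : ∀ n, (0 : ℝ) < (∏ j ∈ Finset.range n, (a (j + 1) - a j) : ℕ) := fun n => by
    exact_mod_cast Finset.prod_pos fun j _ => Nat.sub_pos_of_lt (ha (Nat.lt_succ_self j))
  have hd0 : ∀ {y : ℝ}, 0 ≤ y → 2 ≤ cantorDigit a y 0 := fun hy =>
    h0.trans (cantorDigit_bounds ha hy 0).1
  have key : ∀ n, ((∏ j ∈ Finset.range n, (a (j + 1) - a j) : ℕ) : ℝ)⁻¹ ≤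
      C * (∏ j ∈ Finset.range (n + 2), (a (j + 1) : ℝ)⁻¹) ^ (s : ℝ) := fun n => by
    have ha' : ∀ j, (0 : ℝ) < a (j + 1) := fun j => by
      exact_mod_cast (by omega : 0 < 2).trans_le (h0.trans (ha.monotone (Nat.zero_le _)))
    have hp : (0 : ℝ) < (∏ j ∈ Finset.range (n + 2), (a (j + 1) : ℝ)) ^ (s : ℝ) :=
      Real.rpow_pos_of_pos (Finset.prod_pos fun j _ => ha' j) _
    rw [Finset.prod_inv_distrib, Real.inv_rpow (Finset.prod_nonneg fun j _ => (ha' j).le),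
      ← div_eq_mul_inv, le_div_iff₀ hp, inv_mul_le_iff₀ (hpos n)]
    linarith [hC n]
  have main : ∀ y ∈ Ico (0 : ℝ) 1, ∀ z ∈ Ico (0 : ℝ) 1, ∀ n,
      (∀ j < n, cantorDigit a y j = cantorDigit a z j) → cantorDigit a y n < cantorDigit a z n →
      |y - z| ≤ C * |engelSum (cantorDigit a y) - engelSum (cantorDigit a z)| ^ (s : ℝ) := by
    intro y hy z hz n hn hlt
    refine (abs_sub_le_of_cantorDigit_eq ha hy hz n hn).trans ((key n).trans ?_)
    gcongr
    refine le_trans ?_ (le_abs_self _)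
    refine le_trans ?_ (prod_le_engelSum_sub (cantorDigit_strictMono ha hy.1)
      (cantorDigit_strictMono ha hz.1) (hd0 hy.1) (hd0 hz.1) n hn hlt)
    gcongr with j
    · have := (cantorDigit_strictMono ha hy.1).monotone (Nat.zero_le j)
      exact_mod_cast (by omega : 0 < 2).trans_le ((hd0 hy.1).trans this)
    · exact_mod_cast (cantorDigit_bounds ha hy.1 j).2.le
  -- If all digits agree, `key` holds for every `n`, and `a (j + 1) ≥ 2` makes its right side decay
  -- geometrically.
  have hinj : ∀ y ∈ Ico (0 : ℝ) 1, ∀ z ∈ Ico (0 : ℝ) 1,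
      (∀ n, cantorDigit a y n = cantorDigit a z n) → y = z := by
    intro y hy z hz hyz
    have hz0 : |y - z| ≤ 0 := by
      have ht : Tendsto (fun n : ℕ => (C : ℝ) * ((1 / 2 : ℝ) ^ (s : ℝ)) ^ (n + 2)) atTop
          (𝓝 (C * 0)) :=
        ((tendsto_pow_atTop_nhds_zero_of_lt_one (by positivity)
          (Real.rpow_lt_one (by norm_num) (by norm_num) hs')).comp
            (tendsto_add_atTop_nat 2)).const_mul _
      rw [mul_zero] at ht
      refine ge_of_tendsto' ht fun n => ?_
      refine (abs_sub_le_of_cantorDigit_eq ha hy hz n fun j _ => hyz j).trans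
        ((key n).trans ?_)
      rw [← Real.rpow_natCast, ← Real.rpow_mul (by norm_num), mul_comm (s : ℝ),
        Real.rpow_mul (by norm_num), Real.rpow_natCast]
      gcongr
      rw [← Finset.card_range (n + 2), ← Finset.prod_const, Finset.card_range]
      refine Finset.prod_le_prod (fun _ _ => by positivity) fun j _ => ?_
      rw [one_div]
      gcongr
      exact_mod_cast h0.trans (ha.monotone (Nat.zero_le _))
    exact sub_eq_zero.1 (abs_nonpos_iff.1 hz0)
  refine (le_dimH_image_Ico (g := fun y => engelSum (cantorDigit a y)) hs C ?_).trans
    (dimH_mono ?_)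
  · intro y hy z hz
    by_cases hyz : ∀ n, cantorDigit a y n = cantorDigit a z n
    · rw [hinj y hy z hz hyz, sub_self, abs_zero]; positivity
    · push Not at hyz
      classical
      have hmin : ∀ j < Nat.find hyz, cantorDigit a y j = cantorDigit a z j := fun j hj =>
        not_not.1 (Nat.find_min hyz hj)
      rcases lt_or_gt_of_ne (Nat.find_spec hyz) with hlt | hlt
      · exact main y hy z hz _ hmin hlt
      · have := main z hz y hy _ (fun j hj => (hmin j hj).symm) hlt
        rwa [abs_sub_comm y z, abs_sub_comm (engelSum _)]
  · rintro _ ⟨y, hy, rfl⟩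
    have hd := cantorDigit_strictMono ha hy.1
    refine ⟨engelSum_mem hd (hd0 hy.1), fun k => ⟨engelMap_iterate_engelSum_ne_zero hd (hd0 hy.1) k,
      ?_⟩⟩
    simp only
    rw [engelDigit_engelSum hd (hd0 hy.1)]
    exact cantorDigit_bounds ha hy.1 k

/-! ### Lower bound: polynomial blocks for finite `α` -/

lemma mul_rpow_le_rpow_add_one_sub {x β : ℝ} (hx : 0 < x) (hβ : 1 ≤ β) :
    β * x ^ (β - 1) ≤ (x + 1) ^ β - x ^ β := by
  have h := one_add_mul_self_le_rpow_one_add (s := 1 / x) (by have := one_div_pos.2 hx; linarith) hβ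
  have e : (x + 1) ^ β = x ^ β * (1 + 1 / x) ^ β := by
    rw [← Real.mul_rpow hx.le (by positivity)]
    congr 1
    field_simp
  have e2 : x ^ (β - 1) = x ^ β * (1 / x) := by
    rw [Real.rpow_sub_one hx.ne']; ring
  rw [e, e2]
  have := mul_le_mul_of_nonneg_left h (Real.rpow_pos_of_pos hx β).le
  linarith

/-- Rounding loses less than `1 ≤ x ^ (β - 1)`, which lowers the coefficient from `β` to `β - 1`. -/
lemma floor_rpow_sub {x β : ℝ} (hx : 1 ≤ x) (hβ : 1 < β) :
    (⌊x ^ β⌋₊ : ℝ) + (β - 1) * x ^ (β - 1) < ⌊(x + 1) ^ β⌋₊ := by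
  have h1 := mul_rpow_le_rpow_add_one_sub (zero_lt_one.trans_le hx) hβ.le
  have h2 := Nat.floor_le (Real.rpow_nonneg (zero_le_one.trans hx) β)
  have h3 := Nat.lt_floor_add_one ((x + 1) ^ β)
  have h4 : 1 ≤ x ^ (β - 1) := Real.one_le_rpow hx (by linarith)
  linarith

lemma strictMono_floor_rpow {β : ℝ} (hβ : 1 < β) :
    StrictMono fun j : ℕ => ⌊((j : ℝ) + 2) ^ β⌋₊ :=
  strictMono_nat_of_lt_succ fun n => by
    have h := floor_rpow_sub (x := (n : ℝ) + 2) (by have := n.cast_nonneg (α := ℝ); linarith) hβ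
    have h4 : (0 : ℝ) ≤ ((n : ℝ) + 2) ^ (β - 1) := by positivity
    have h5 : (0 : ℝ) ≤ (β - 1) * ((n : ℝ) + 2) ^ (β - 1) := mul_nonneg (by linarith) h4
    have : (⌊((n : ℝ) + 2) ^ β⌋₊ : ℝ) < ⌊((n : ℝ) + 2 + 1) ^ β⌋₊ := by linarith
    rw [Nat.cast_lt] at this
    rwa [show (n : ℝ) + 2 + 1 = ((n + 1 : ℕ) : ℝ) + 2 by push_cast; ring] at this

lemma two_le_floor_rpow {β : ℝ} (hβ : 1 < β) : 2 ≤ ⌊(((0 : ℕ) : ℝ) + 2) ^ β⌋₊ := by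
  refine Nat.le_floor ?_
  have := Real.rpow_le_rpow_of_exponent_le (x := 2) (by norm_num) hβ.le
  simpa using this

lemma eventually_floor_rpow_le {β s : ℝ} (hβ : 1 < β) (hs : 0 < s) (hsβ : β * s < β - 1) :
    ∀ᶠ n : ℕ in atTop, ((⌊(((n + 3 : ℕ) : ℝ) + 2) ^ β⌋₊ : ℕ) : ℝ) ^ s ≤
      (⌊(((n + 1 : ℕ) : ℝ) + 2) ^ β⌋₊ - ⌊((n : ℝ) + 2) ^ β⌋₊ : ℕ) := by
  have ht : Tendsto (fun n : ℕ => (β - 1) * ((n : ℝ) + 2) ^ (β - 1 - β * s)) atTop atTop :=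
    ((tendsto_rpow_atTop (by linarith)).comp
      (tendsto_atTop_add_const_right _ _ tendsto_natCast_atTop_atTop)).const_mul_atTop (by linarith)
  -- The constant comes from `n + 5 ≤ 3 * (n + 2)`.
  filter_upwards [ht.eventually_ge_atTop ((3 : ℝ) ^ (β * s))] with n hn
  have hn0 : (0 : ℝ) ≤ n := n.cast_nonneg
  have h := floor_rpow_sub (x := (n : ℝ) + 2) (by linarith) hβ
  have hle := (strictMono_floor_rpow hβ).monotone (Nat.le_succ n)
  rw [Nat.cast_sub (by simpa using hle)]
  have e : (((n + 1 : ℕ) : ℝ) + 2) = (n : ℝ) + 2 + 1 := by push_cast; ring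
  rw [e]
  calc ((⌊(((n + 3 : ℕ) : ℝ) + 2) ^ β⌋₊ : ℕ) : ℝ) ^ s
      ≤ ((((n + 3 : ℕ) : ℝ) + 2) ^ β) ^ s := by
        gcongr; exact Nat.floor_le (by positivity)
    _ = (((n + 3 : ℕ) : ℝ) + 2) ^ (β * s) := by rw [← Real.rpow_mul (by positivity)]
    _ ≤ (3 * ((n : ℝ) + 2)) ^ (β * s) := by
        gcongr; push_cast; linarith
    _ = 3 ^ (β * s) * ((n : ℝ) + 2) ^ (β * s) := Real.mul_rpow (by norm_num) (by positivity)
    _ ≤ (β - 1) * ((n : ℝ) + 2) ^ (β - 1 - β * s) * ((n : ℝ) + 2) ^ (β * s) := by gcongr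
    _ = (β - 1) * ((n : ℝ) + 2) ^ (β - 1) := by
        rw [mul_assoc, ← Real.rpow_add (by positivity)]; ring_nf
    _ ≤ _ := by linarith

lemma tendsto_log_natCast_add_one : Tendsto (fun k : ℕ => Real.log ((k : ℝ) + 1)) atTop atTop :=
  Real.tendsto_log_atTop.comp
    (tendsto_atTop_add_const_right _ _ tendsto_natCast_atTop_atTop)

lemma engelLogRate_eq_of_ne_zero {x : ℝ} (hx : ∀ k, engelMap^[k] x ≠ 0) :
    engelLogRate x = liminf (fun k : ℕ =>
      ENNReal.ofReal (Real.log (engelDigit x k : ℝ) / Real.log ((k : ℝ) + 1))) atTop := by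
  rw [engelLogRate, if_neg (by push Not; exact hx)]

/-- The digits lie between `(k + 1) ^ β` and `(3 * (k + 1)) ^ β`: consecutive powers are at least
`1` apart, which absorbs the floor, and `k + 3 ≤ 3 * (k + 1)`. -/
lemma engelLogRate_eq_of_floor_rpow {x β : ℝ} (hβ : 1 < β) (hx : ∀ k, engelMap^[k] x ≠ 0 ∧
    ⌊((k : ℝ) + 2) ^ β⌋₊ ≤ engelDigit x k ∧ engelDigit x k < ⌊(((k + 1 : ℕ) : ℝ) + 2) ^ β⌋₊) :
    engelLogRate x = ENNReal.ofReal β := by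
  rw [engelLogRate_eq_of_ne_zero fun k => (hx k).1]
  refine Tendsto.liminf_eq (ENNReal.tendsto_ofReal ?_)
  have hup : Tendsto (fun k : ℕ => β * (1 + Real.log 3 / Real.log ((k : ℝ) + 1))) atTop
      (𝓝 (β * (1 + 0))) :=
    ((tendsto_log_natCast_add_one.const_div_atTop _).const_add 1).const_mul β
  rw [add_zero, mul_one] at hup
  refine tendsto_of_tendsto_of_tendsto_of_le_of_le' tendsto_const_nhds hup ?_ ?_
  · filter_upwards [tendsto_log_natCast_add_one.eventually_gt_atTop 0] with k hk
    have hk0 : (0 : ℝ) ≤ k := k.cast_nonneg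
    rw [le_div_iff₀ hk, ← Real.log_rpow (by positivity)]
    refine Real.log_le_log (by positivity) ?_
    have h1 := mul_rpow_le_rpow_add_one_sub (x := (k : ℝ) + 1) (by positivity) hβ.le
    have h4 : 1 ≤ ((k : ℝ) + 1) ^ (β - 1) := Real.one_le_rpow (by linarith) (by linarith)
    have h5 : 1 ≤ β * ((k : ℝ) + 1) ^ (β - 1) := one_le_mul_of_one_le_of_one_le hβ.le h4
    have h3 := Nat.lt_floor_add_one (((k : ℝ) + 2) ^ β)
    have h6 : (⌊((k : ℝ) + 2) ^ β⌋₊ : ℝ) ≤ engelDigit x k := by exact_mod_cast (hx k).2.1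
    rw [show (k : ℝ) + 1 + 1 = k + 2 by ring] at h1
    linarith
  · filter_upwards [tendsto_log_natCast_add_one.eventually_gt_atTop 0] with k hk
    have hk0 : (0 : ℝ) ≤ k := k.cast_nonneg
    have e : β * (1 + Real.log 3 / Real.log ((k : ℝ) + 1)) =
        β * Real.log (3 * ((k : ℝ) + 1)) / Real.log ((k : ℝ) + 1) := by
      rw [Real.log_mul (by norm_num) (by positivity)]
      field_simp
      ring
    rw [e, ← Real.log_rpow (by positivity)]
    gcongr
    · have h2 := (strictMono_floor_rpow hβ).monotone (Nat.zero_le k)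
      have := (two_le_floor_rpow hβ).trans (h2.trans (hx k).2.1)
      exact_mod_cast (by omega : 0 < 2).trans_le this
    · have h6 : (engelDigit x k : ℝ) ≤ ⌊(((k + 1 : ℕ) : ℝ) + 2) ^ β⌋₊ := by
        exact_mod_cast (hx k).2.2.le
      refine h6.trans ((Nat.floor_le (by positivity)).trans ?_)
      gcongr
      push_cast; linarith

lemma le_dimH_engelLogRate_eq {β : ℝ} {s : ℝ≥0} (hβ : 1 < β) (hs : 0 < s) (hsβ : β * s < β - 1) :
    (s : ℝ≥0∞) ≤ dimH {x : ℝ | x ∈ Ioo (0 : ℝ) 1 ∧ engelLogRate x = ENNReal.ofReal β} :=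
  (le_dimH_engelDigit_blocks (strictMono_floor_rpow hβ) (two_le_floor_rpow hβ) hs
    (eventually_floor_rpow_le hβ hs hsβ)).trans
    (dimH_mono fun _ hx => ⟨hx.1, engelLogRate_eq_of_floor_rpow hβ hx.2⟩)

/-! ### Lower bound: dyadic blocks for `α = ∞` -/

lemma eventually_two_pow_le {s : ℝ} (hs1 : s < 1) :
    ∀ᶠ n : ℕ in atTop, ((2 ^ (n + 3 + 1) : ℕ) : ℝ) ^ s ≤ (2 ^ (n + 1 + 1) - 2 ^ (n + 1) : ℕ) := by
  have ht : Tendsto (fun n : ℕ => (1 - s) * (n : ℝ)) atTop atTop :=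
    tendsto_natCast_atTop_atTop.const_mul_atTop (by linarith)
  filter_upwards [ht.eventually_ge_atTop (4 * s)] with n hn
  have e : 2 ^ (n + 1 + 1) - 2 ^ (n + 1) = 2 ^ (n + 1) := by rw [pow_succ _ (n + 1)]; omega
  rw [e]
  push_cast
  rw [← Real.rpow_natCast, ← Real.rpow_natCast, ← Real.rpow_mul (by norm_num)]
  refine Real.rpow_le_rpow_of_exponent_le (by norm_num) ?_
  push_cast
  linarith

lemma engelLogRate_eq_top_of_two_pow_le {x : ℝ} (hx : ∀ k, engelMap^[k] x ≠ 0 ∧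
    2 ^ (k + 1) ≤ engelDigit x k) : engelLogRate x = ⊤ := by
  rw [engelLogRate_eq_of_ne_zero fun k => (hx k).1]
  refine Tendsto.liminf_eq (ENNReal.tendsto_ofReal_nhds_top.2 ?_)
  have h1 : Tendsto (fun y : ℝ => y / Real.log y) atTop atTop := by
    have h2 : Tendsto (fun y : ℝ => Real.log y / y) atTop (𝓝[>] 0) := by
      refine tendsto_nhdsWithin_iff.2 ⟨Real.isLittleO_log_id_atTop.tendsto_div_nhds_zero, ?_⟩
      filter_upwards [eventually_gt_atTop 1] with y hy
      exact div_pos (Real.log_pos hy) (by linarith)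
    refine h2.inv_tendsto_nhdsGT_zero.congr fun y => ?_
    rw [Pi.inv_apply, inv_div]
  have h3 : Tendsto (fun k : ℕ => Real.log 2 * (((k : ℝ) + 1) / Real.log ((k : ℝ) + 1)))
      atTop atTop :=
    (h1.comp (tendsto_atTop_add_const_right _ _ tendsto_natCast_atTop_atTop)).const_mul_atTop
      (Real.log_pos (by norm_num))
  refine tendsto_atTop_mono' _ ?_ h3
  filter_upwards [tendsto_log_natCast_add_one.eventually_gt_atTop 0] with k hk
  rw [← mul_div_assoc]
  gcongr
  have : ((2 : ℝ) ^ (k + 1)) ≤ engelDigit x k := by exact_mod_cast (hx k).2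
  calc Real.log 2 * ((k : ℝ) + 1) = Real.log (2 ^ (k + 1)) := by
        rw [Real.log_pow]; push_cast; ring
    _ ≤ _ := Real.log_le_log (by positivity) this

lemma le_dimH_engelLogRate_eq_top {s : ℝ≥0} (hs : 0 < s) (hs1 : s < 1) :
    (s : ℝ≥0∞) ≤ dimH {x : ℝ | x ∈ Ioo (0 : ℝ) 1 ∧ engelLogRate x = ⊤} :=
  (le_dimH_engelDigit_blocks (a := fun n => 2 ^ (n + 1))
    (fun _ _ h => Nat.pow_lt_pow_right (by norm_num) (by omega)) (by norm_num) hs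
    (eventually_two_pow_le hs1)).trans
    (dimH_mono fun _ hx => ⟨hx.1, engelLogRate_eq_top_of_two_pow_le fun k =>
      ⟨(hx.2 k).1, (hx.2 k).2.1⟩⟩)

/-! ### Upper bound: cylinder covers and a generating function -/

/-- The outer measure obtained from countable covers by sets of diameter at most `δ`, whose limit
as `δ → 0` is the `s`-dimensional Hausdorff measure. -/
noncomputable def hausdorffPre (s : ℝ) (δ : ℝ≥0∞) : OuterMeasure ℝ :=
  OuterMeasure.mkMetric'.pre (fun S => Metric.ediam S ^ s) δ

lemma hausdorffPre_anti (s : ℝ) {δ ε : ℝ≥0∞} (h : δ ≤ ε) (S : Set ℝ) :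
    hausdorffPre s ε S ≤ hausdorffPre s δ S :=
  OuterMeasure.mkMetric'.mono_pre _ h S

/-- The pre-measure is the largest outer measure dominated by `diam ^ s` on sets of diameter at most
`δ`, so it suffices to test the rescaled pullback on such sets. -/
lemma hausdorffPre_image_le {s : ℝ} (hs : 0 ≤ s) {K : ℝ≥0} (hK : 0 < K) {φ : ℝ → ℝ}
    (hφ : LipschitzWith K φ) (δ : ℝ≥0∞) (S : Set ℝ) :
    hausdorffPre s (K * δ) (φ '' S) ≤ (K : ℝ≥0∞) ^ s * hausdorffPre s δ S := by
  have hK0 : (K : ℝ≥0∞) ^ s ≠ 0 := by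
    rw [← ENNReal.coe_rpow_of_nonneg _ hs]
    exact_mod_cast (NNReal.rpow_pos hK).ne'
  have hKt : (K : ℝ≥0∞) ^ s ≠ ⊤ := ENNReal.rpow_ne_top_of_nonneg hs ENNReal.coe_ne_top
  have hle : ((K : ℝ≥0∞) ^ s)⁻¹ • OuterMeasure.comap φ (hausdorffPre s (K * δ)) ≤
      hausdorffPre s δ := by
    refine OuterMeasure.mkMetric'.le_pre.2 fun S hS => ?_
    have hd := hφ.ediam_image_le S
    rw [smul_apply, OuterMeasure.comap_apply, smul_eq_mul,
      ENNReal.inv_mul_le_iff hK0 hKt, ← ENNReal.mul_rpow_of_nonneg _ _ hs]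
    refine (OuterMeasure.mkMetric'.pre_le (hd.trans (by gcongr))).trans ?_
    exact ENNReal.rpow_le_rpow hd hs
  have h := hle S
  rwa [smul_apply, OuterMeasure.comap_apply, smul_eq_mul,
    ENNReal.inv_mul_le_iff hK0 hKt] at h

lemma hausdorffMeasure_eq_zero_of_hausdorffPre {s : ℝ} {S : Set ℝ}
    (h : ∀ δ > 0, hausdorffPre s δ S = 0) : Measure.hausdorffMeasure s S = 0 := by
  have h1 : Measure.hausdorffMeasure s S = OuterMeasure.mkMetric (fun r => r ^ s) S := by
    rw [OuterMeasure.coe_mkMetric]; rfl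
  rw [h1, OuterMeasure.mkMetric, OuterMeasure.mkMetric'.eq_iSup_nat, OuterMeasure.iSup_apply]
  simp only [ENNReal.iSup_eq_zero]
  intro n
  exact h _ (by simp)

/-- The points with at least `n` Engel digits, the first `n` of which lie in `[m, M]`. -/
def engelDigitSet (n m M : ℕ) : Set ℝ :=
  {x | x ∈ Ico (0 : ℝ) 1 ∧ ∀ k < n, engelMap^[k] x ≠ 0 ∧ m ≤ engelDigit x k ∧ engelDigit x k ≤ M}

/-- Either the first digit is `m` and `x = (1 + T x) / m`, or it is at least `m + 1` and, by
monotonicity, so are the others. -/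
lemma engelDigitSet_succ_subset {n m M : ℕ} (hm : 0 < m) :
    engelDigitSet (n + 1) m M ⊆
      engelDigitSet (n + 1) (m + 1) M ∪ (fun y : ℝ => (1 + y) / m) '' engelDigitSet n m M := by
  rintro x ⟨hx, h⟩
  have h0 := h 0 (by omega)
  have hx0 : x ∈ Ioo (0 : ℝ) 1 := engelMap_iterate_mem_Ioo (k := 0) hx h0.1
  rcases h0.2.1.eq_or_lt with heq | hlt
  · right
    refine ⟨engelMap x, ⟨engelMap_mem_Ico hx, fun k hk => h (k + 1) (by omega)⟩, ?_⟩
    have hm' : (m : ℝ) ≠ 0 := by exact_mod_cast hm.ne'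
    simp only
    rw [engelMap_eq hx0, ← engelDigit_zero, ← heq]
    field_simp
    ring
  · left
    exact ⟨hx, fun k hk => ⟨(h k hk).1,
      hlt.trans_le (engelDigit_le_of_le hx (Nat.zero_le k) (h k hk).1), (h k hk).2.2⟩⟩

lemma engelDigitSet_succ_eq_empty {n m M : ℕ} (h : M < m) : engelDigitSet (n + 1) m M = ∅ := by
  refine eq_empty_of_forall_notMem fun x hx => ?_
  have := (hx.2 0 (by omega)).2
  omega

lemma lipschitzWith_one_add_div (m : ℕ) : LipschitzWith ((m : ℝ≥0)⁻¹) fun y : ℝ => (1 + y) / m := by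
  refine LipschitzWith.of_dist_le_mul fun x y => le_of_eq ?_
  rw [Real.dist_eq, Real.dist_eq, ← sub_div, abs_div, Nat.abs_cast]
  push_cast
  rw [add_sub_add_left_eq_sub, div_eq_inv_mul]

/-- A generating function bound: `∑ (d 1 ⋯ d n) ^ (-s)` over nondecreasing sequences in `[m, M]` is
at most `t ^ (-n) ∏ (1 - t k ^ (-s))⁻¹`. -/
lemma hausdorffPre_engelDigitSet_le {s t : ℝ} (hs : 0 ≤ s) (ht : 0 < t)
    (hts : ∀ k : ℕ, 2 ≤ k → t * (k : ℝ) ^ (-s) < 1) (M n : ℕ) : ∀ m, 2 ≤ m →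
    hausdorffPre s (2⁻¹ ^ n) (engelDigitSet n m M) ≤
      ENNReal.ofReal (t⁻¹ ^ n * ∏ k ∈ Finset.Ico m (M + 1), (1 - t * (k : ℝ) ^ (-s))⁻¹) := by
  have hP : ∀ m, 2 ≤ m → 0 ≤ ∏ k ∈ Finset.Ico m (M + 1), (1 - t * (k : ℝ) ^ (-s))⁻¹ :=
    fun m hm => Finset.prod_nonneg fun k hk => inv_nonneg.2 (by
      have := hts k (hm.trans (Finset.mem_Ico.1 hk).1); linarith)
  induction n with
  | zero =>
    intro m hm
    have hd : Metric.ediam (engelDigitSet 0 m M) ≤ 1 := by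
      refine (Metric.ediam_mono fun x hx => hx.1).trans (le_of_eq ?_) (b := Metric.ediam (Ico (0 : ℝ) 1))
      rw [Real.ediam_Ico]; simp
    refine (OuterMeasure.mkMetric'.pre_le (by simpa using hd)).trans ?_
    refine (ENNReal.rpow_le_one hd hs).trans ?_
    rw [ENNReal.one_le_ofReal, pow_zero, one_mul]
    refine Finset.prod_const_one.symm.trans_le
      (Finset.prod_le_prod (fun _ _ => zero_le_one) fun k hk => ?_)
    have h1 := hts k (hm.trans (Finset.mem_Ico.1 hk).1)
    have h2 : 0 ≤ t * (k : ℝ) ^ (-s) := by positivity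
    exact (one_le_inv₀ (by linarith)).2 (by linarith)
  | succ n ih =>
    intro m hm
    -- Inner induction upon the number of values in `[m, M]`: the splitting reduces `(n + 1, m)` to
    -- `(n + 1, m + 1)` and `(n, m)`.
    obtain ⟨j, hj⟩ : ∃ j, M + 1 - m = j := ⟨_, rfl⟩
    induction j generalizing m with
    | zero =>
      rw [engelDigitSet_succ_eq_empty (by omega), measure_empty]
      exact zero_le
    | succ j ihj =>
      have h1 := ihj (m + 1) (by omega) (by omega)
      have hm0 : (0 : ℝ) < m := by exact_mod_cast (by omega : 0 < m)
      have hq := hts m hm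
      have h2 : hausdorffPre s (2⁻¹ ^ (n + 1))
          ((fun y : ℝ => (1 + y) / m) '' engelDigitSet n m M) ≤
          ENNReal.ofReal ((m : ℝ) ^ (-s) *
            (t⁻¹ ^ n * ∏ k ∈ Finset.Ico m (M + 1), (1 - t * (k : ℝ) ^ (-s))⁻¹)) := by
        -- Each inverse branch at least halves diameters, as `m ≥ 2`; hence the scale `2⁻¹ ^ n`.
        have hle : (((m : ℝ≥0)⁻¹ : ℝ≥0) : ℝ≥0∞) ≤ 2⁻¹ := by
          rw [ENNReal.coe_inv (by exact_mod_cast (by omega : m ≠ 0)), ENNReal.coe_natCast]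
          exact ENNReal.inv_le_inv.2 (by exact_mod_cast hm)
        have hK : (((m : ℝ≥0)⁻¹ : ℝ≥0) : ℝ≥0∞) ^ s = ENNReal.ofReal ((m : ℝ) ^ (-s)) := by
          rw [Real.rpow_neg hm0.le, ← Real.inv_rpow hm0.le, ← ENNReal.ofReal_rpow_of_nonneg
            (by positivity) hs]
          congr 1
          rw [ENNReal.ofReal, Real.toNNReal_inv, Real.toNNReal_natCast]
        rw [ENNReal.ofReal_mul (by positivity), ← hK]
        refine le_trans ?_ ((hausdorffPre_image_le hs (by positivity)
          (lipschitzWith_one_add_div m) (2⁻¹ ^ n) _).trans (by gcongr; exact ih m hm))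
        refine hausdorffPre_anti s ?_ _
        rw [pow_succ']
        gcongr
      refine ((measure_mono (engelDigitSet_succ_subset (by omega))).trans
        (measure_union_le _ _)).trans ((add_le_add h1 h2).trans ?_)
      have hPm := hP m hm
      rw [← ENNReal.ofReal_add (mul_nonneg (by positivity) (hP _ (by omega)))
        (mul_nonneg (by positivity) (mul_nonneg (by positivity) hPm))]
      -- With `q = t * m ^ (-s)` and `P` the product from `m`, this is `t⁻¹ ^ (n + 1) * P * ((1 - q)
      -- + q)`.
      refine ENNReal.ofReal_le_ofReal (le_of_eq ?_)
      rw [Finset.prod_eq_prod_Ico_succ_bot (by omega : m < M + 1)]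
      have : 1 - t * (m : ℝ) ^ (-s) ≠ 0 := by linarith
      rw [pow_succ]
      field_simp
      ring

/-- A telescoping form of `(x + 1) ^ (-s) ≤ ∫ y ^ (-s)` over `[x, x + 1]`, from Bernoulli's
inequality with exponent `1 - s ≤ 1`. -/
lemma rpow_neg_le_sub {s x : ℝ} (hs0 : 0 ≤ s) (hs1 : s < 1) (hx : 0 ≤ x) :
    (x + 1) ^ (-s) ≤ ((x + 1) ^ (1 - s) - x ^ (1 - s)) / (1 - s) := by
  have hx1 : 0 < x + 1 := by linarith
  have h := rpow_one_add_le_one_add_mul_self (s := -(1 / (x + 1))) (p := 1 - s)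
    (by rw [neg_le_neg_iff, div_le_one hx1]; linarith) (by linarith) (by linarith)
  have e : x ^ (1 - s) = (x + 1) ^ (1 - s) * (1 + -(1 / (x + 1))) ^ (1 - s) := by
    rw [← Real.mul_rpow hx1.le (by rw [← sub_eq_add_neg, sub_nonneg, div_le_one hx1]; linarith)]
    congr 1
    field_simp
    ring
  have e2 : (x + 1) ^ (-s) = (x + 1) ^ (1 - s) * (1 / (x + 1)) := by
    rw [show -s = 1 - s - 1 by ring, Real.rpow_sub_one hx1.ne']; ring
  rw [le_div_iff₀ (by linarith), e, e2]
  have := mul_le_mul_of_nonneg_left h (Real.rpow_pos_of_pos hx1 (1 - s)).le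
  linarith

/-- Each factor satisfies `(1 - u)⁻¹ ≤ exp (u / (1 - u))`, with `1 - u` smallest at `k = 2`; the
exponents telescope by `rpow_neg_le_sub`. -/
lemma prod_inv_one_sub_le {s t : ℝ} (hs0 : 0 ≤ s) (hs1 : s < 1) (ht : 0 ≤ t)
    (hts : t * 2 ^ (-s) < 1) (M : ℕ) :
    ∏ k ∈ Finset.Ico 2 (M + 1), (1 - t * (k : ℝ) ^ (-s))⁻¹ ≤
      Real.exp (t / (1 - t * 2 ^ (-s)) / (1 - s) * (M : ℝ) ^ (1 - s)) := by
  have hq : 0 < 1 - t * 2 ^ (-s) := by linarith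
  have h1s : 0 < 1 - s := by linarith
  induction M with
  | zero =>
    simp only [zero_add, Finset.Ico_eq_empty_of_le (by norm_num : 1 ≤ 2), Finset.prod_empty]
    exact Real.one_le_exp (by positivity)
  | succ M ih =>
    rcases Nat.eq_zero_or_pos M with rfl | hM
    · simp only [zero_add, one_add_one_eq_two, Finset.Ico_self, Finset.prod_empty]
      exact Real.one_le_exp (by positivity)
    rw [Finset.prod_Ico_succ_top (by omega)]
    set u : ℝ := t * ((M + 1 : ℕ) : ℝ) ^ (-s) with hu
    have hu0 : 0 ≤ u := by positivity
    have huq : u ≤ t * 2 ^ (-s) := by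
      refine mul_le_mul_of_nonneg_left ?_ ht
      exact Real.rpow_le_rpow_of_nonpos (by norm_num) (by exact_mod_cast (by omega : 2 ≤ M + 1))
        (by linarith)
    have hfac : (1 - u)⁻¹ ≤ Real.exp (u / (1 - t * 2 ^ (-s))) := by
      have e : (1 - u)⁻¹ = u / (1 - u) + 1 := by
        have : 1 - u ≠ 0 := by linarith
        field_simp
        ring
      rw [e]
      refine (Real.add_one_le_exp _).trans (Real.exp_le_exp.2 ?_)
      gcongr
    have hexp : u / (1 - t * 2 ^ (-s)) ≤ t / (1 - t * 2 ^ (-s)) / (1 - s) *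
        (((M + 1 : ℕ) : ℝ) ^ (1 - s) - (M : ℝ) ^ (1 - s)) := by
      have h := rpow_neg_le_sub hs0 hs1 M.cast_nonneg
      rw [hu]
      push_cast
      calc t * ((M : ℝ) + 1) ^ (-s) / (1 - t * 2 ^ (-s))
          = t / (1 - t * 2 ^ (-s)) * ((M : ℝ) + 1) ^ (-s) := by ring
        _ ≤ t / (1 - t * 2 ^ (-s)) *
            ((((M : ℝ) + 1) ^ (1 - s) - (M : ℝ) ^ (1 - s)) / (1 - s)) := by gcongr
        _ = _ := by ring
    calc _ ≤ Real.exp (t / (1 - t * 2 ^ (-s)) / (1 - s) * (M : ℝ) ^ (1 - s)) *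
          Real.exp (t / (1 - t * 2 ^ (-s)) / (1 - s) *
            (((M + 1 : ℕ) : ℝ) ^ (1 - s) - (M : ℝ) ^ (1 - s))) := by
          refine mul_le_mul ih (hfac.trans (Real.exp_le_exp.2 hexp)) ?_ (Real.exp_pos _).le
          exact inv_nonneg.2 (by linarith)
      _ = _ := by rw [← Real.exp_add]; congr 1; ring

lemma summable_inv_pow_mul_exp_rpow {t K γ : ℝ} (ht : 1 < t) (hγ : γ < 1) :
    Summable fun n : ℕ => t⁻¹ ^ n * Real.exp (K * (n : ℝ) ^ γ) := by
  have hlog := Real.log_pos ht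
  have hsum : Summable fun n : ℕ => Real.exp (-(Real.log t / 2)) ^ n :=
    summable_geometric_of_lt_one (Real.exp_pos _).le (by rw [Real.exp_lt_one_iff]; linarith)
  refine Summable.of_norm_bounded_eventually_nat hsum ?_
  have hz : Tendsto (fun n : ℕ => K * (n : ℝ) ^ (-(1 - γ))) atTop (𝓝 (K * 0)) :=
    ((tendsto_rpow_neg_atTop (by linarith)).comp tendsto_natCast_atTop_atTop).const_mul K
  rw [mul_zero] at hz
  filter_upwards [hz.eventually_le_const (half_pos hlog), eventually_gt_atTop 0] with n hn hn0
  have hn0' : (0 : ℝ) < n := by exact_mod_cast hn0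
  have e : (n : ℝ) ^ γ = (n : ℝ) ^ (-(1 - γ)) * n := by
    rw [← Real.rpow_add_one hn0'.ne']; congr 1; ring
  rw [Real.norm_of_nonneg (by positivity), ← Real.exp_nat_mul, ← Real.exp_log (by positivity : 0 < t),
    ← Real.exp_neg, ← Real.exp_nat_mul, ← Real.exp_add, Real.exp_log (by positivity), e]
  refine Real.exp_le_exp.2 ?_
  have := mul_le_mul_of_nonneg_right hn hn0'.le
  linarith

lemma hausdorffMeasure_frequently_engelDigit_lt {s τ : ℝ} (hs0 : 0 < s) (hs1 : s < 1)
    (hsτ : τ * (1 - s) < 1) :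
    Measure.hausdorffMeasure s {x : ℝ | x ∈ Ioo (0 : ℝ) 1 ∧ (∀ k, engelMap^[k] x ≠ 0) ∧
      ∃ᶠ k : ℕ in atTop, (engelDigit x k : ℝ) < ((k : ℝ) + 1) ^ τ} = 0 := by
  refine hausdorffMeasure_eq_zero_of_hausdorffPre fun δ hδ => ?_
  -- Any `t` strictly between `1` and `2 ^ s` serves: `t > 1` gives geometric decay, `t < 2 ^ s`
  -- keeps the factors finite.
  set t : ℝ := 2 ^ (s / 2) with ht
  have ht1 : 1 < t := Real.one_lt_rpow (by norm_num) (by linarith)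
  have hts : t * 2 ^ (-s) < 1 := by
    rw [ht, ← Real.rpow_add (by norm_num)]
    exact Real.rpow_lt_one_of_one_lt_of_neg (by norm_num) (by linarith)
  have hts' : ∀ k : ℕ, 2 ≤ k → t * (k : ℝ) ^ (-s) < 1 := fun k hk => by
    refine lt_of_le_of_lt (mul_le_mul_of_nonneg_left ?_ (by positivity)) hts
    exact Real.rpow_le_rpow_of_nonpos (by norm_num) (by exact_mod_cast hk) (by linarith)
  set K : ℝ := t / (1 - t * 2 ^ (-s)) / (1 - s) with hK
  have hK0 : 0 ≤ K := by
    have : 0 < 1 - t * 2 ^ (-s) := by linarith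
    have : 0 < 1 - s := by linarith
    positivity
  obtain ⟨N, hN⟩ : ∃ N : ℕ, (2⁻¹ : ℝ≥0∞) ^ N < δ := 
    ((ENNReal.tendsto_pow_atTop_nhds_zero_of_lt_one (by norm_num)).eventually_lt_const hδ).exists
  have hcost : ∀ n, N ≤ n → hausdorffPre s δ (engelDigitSet n 2 ⌊(n : ℝ) ^ τ⌋₊) ≤
      ENNReal.ofReal (t⁻¹ ^ n * Real.exp (K * (n : ℝ) ^ (τ * (1 - s)))) := fun n hn => by
    have hδn : (2⁻¹ : ℝ≥0∞) ^ n ≤ δ :=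
      (pow_le_pow_of_le_one (zero_le) (by norm_num) hn).trans hN.le
    refine (hausdorffPre_anti s hδn _).trans ((hausdorffPre_engelDigitSet_le hs0.le (by linarith)
      hts' _ n 2 le_rfl).trans (ENNReal.ofReal_le_ofReal ?_))
    gcongr
    refine (prod_inv_one_sub_le hs0.le hs1 (by linarith) hts _).trans (Real.exp_le_exp.2 ?_)
    rw [Real.rpow_mul n.cast_nonneg]
    refine mul_le_mul_of_nonneg_left ?_ hK0
    exact Real.rpow_le_rpow (by positivity) (Nat.floor_le (by positivity)) (by linarith)
  have hsum := (summable_nat_add_iff N).2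
    (summable_inv_pow_mul_exp_rpow (K := K) (γ := τ * (1 - s)) ht1 hsτ)
  have hlim := measure_limsup_atTop_eq_zero (μ := hausdorffPre s δ)
    (s := fun n => engelDigitSet (n + N) 2 ⌊((n + N : ℕ) : ℝ) ^ τ⌋₊)
    (ne_top_of_le_ne_top hsum.tsum_ofReal_ne_top
      (ENNReal.tsum_le_tsum fun n => hcost (n + N) (by omega)))
  refine measure_mono_null ?_ hlim
  rintro x ⟨hx, hne, hfreq⟩
  have hx' : x ∈ Ico (0 : ℝ) 1 := ⟨hx.1.le, hx.2⟩
  rw [mem_limsup_iff_frequently_mem, frequently_atTop]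
  intro n
  obtain ⟨k, hk, hlt⟩ := frequently_atTop.1 hfreq (n + N)
  -- `engelDigit x k` is the digit number `k + 1`, so it bounds the first `k + 1` digits by `(k + 1)
  -- ^ τ`.
  refine ⟨k + 1 - N, by omega, hx', fun j hj => ⟨hne j, two_le_engelDigit hx' (hne j), ?_⟩⟩
  rw [show k + 1 - N + N = k + 1 by omega] at hj ⊢
  refine (engelDigit_le_of_le hx' (by omega : j ≤ k) (hne k)).trans (Nat.le_floor ?_)
  push_cast
  exact hlt.le

/-! ### The exponent of convergence is the inverse of the logarithmic rate -/

lemma engelLogRate_eq_top_of_eq_zero {x : ℝ} (h : ∃ k, engelMap^[k] x = 0) :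
    engelLogRate x = ⊤ := by
  rw [engelLogRate, if_pos h]

lemma engelExponent_eq_zero_of_eq_zero {x : ℝ} (h : ∃ k, engelMap^[k] x = 0) :
    engelExponent x = 0 := by
  obtain ⟨k, hk⟩ := h
  have hfin : {j : ℕ | engelMap^[j] x ≠ 0}.Finite := (finite_Iio k).subset fun j hj =>
    lt_of_not_ge fun hkj => hj (engelMap_iterate_eq_zero_of_le hkj hk)
  have : Finite {j : ℕ // engelMap^[j] x ≠ 0} := hfin
  have hs : Summable fun k : {k : ℕ // engelMap^[k] x ≠ 0} =>
      ((engelDigit x k : ℕ) : ℝ) ^ (-((0 : ℝ≥0) : ℝ)) := Summable.of_finite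
  have hle : engelExponent x ≤ ((0 : ℝ≥0) : ℝ≥0∞) := by
    rw [engelExponent, convergenceExponent]
    exact iInf₂_le (0 : ℝ≥0) hs
  simpa using hle

lemma engelExponent_eq_of_ne_zero {x : ℝ} (hx : ∀ k, engelMap^[k] x ≠ 0) :
    engelExponent x = convergenceExponent (engelDigit x) := by
  have (s : ℝ≥0) : (Summable fun k : {k : ℕ // engelMap^[k] x ≠ 0} =>
      ((engelDigit x k : ℕ) : ℝ) ^ (-(s : ℝ))) ↔
      Summable fun k => (engelDigit x k : ℝ) ^ (-(s : ℝ)) :=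
    (Equiv.subtypeUnivEquiv hx).summable_iff (f := fun k => (engelDigit x k : ℝ) ^ (-(s : ℝ)))
  simp only [engelExponent, convergenceExponent, this]

lemma summable_rpow_neg_of_lt_liminf {d : ℕ → ℕ} (hd : ∀ k, 0 < d k) {s : ℝ≥0}
    (h : (s : ℝ≥0∞)⁻¹ < liminf (fun k : ℕ =>
      ENNReal.ofReal (Real.log (d k : ℝ) / Real.log ((k : ℝ) + 1))) atTop) :
    Summable fun k => (d k : ℝ) ^ (-(s : ℝ)) := by
  obtain ⟨τ, h1, h2⟩ := ENNReal.lt_iff_exists_nnreal_btwn.1 h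
  have hτs : 1 < (τ : ℝ) * s := by
    have h3 : (1 : ℝ≥0∞) < τ * s := by
      rcases eq_or_ne s 0 with rfl | hs
      · simp at h1
      · rwa [← one_div, ENNReal.div_lt_iff (Or.inl (by exact_mod_cast hs))
          (Or.inl ENNReal.coe_ne_top)] at h1
    exact_mod_cast h3
  have hsum : Summable fun k : ℕ => ((k : ℝ) + 1) ^ (-((τ : ℝ) * s)) := by
    have := (summable_nat_add_iff 1).2 (Real.summable_nat_rpow.2 (by linarith : -((τ : ℝ) * s) < -1))
    simpa using this
  refine Summable.of_norm_bounded_eventually_nat hsum ?_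
  filter_upwards [eventually_lt_of_lt_liminf h2,
    tendsto_log_natCast_add_one.eventually_gt_atTop 0] with k hk hlog
  have hdk : (0 : ℝ) < d k := by exact_mod_cast hd k
  rw [← ENNReal.ofReal_coe_nnreal, ENNReal.ofReal_lt_ofReal_iff_of_nonneg τ.coe_nonneg,
    lt_div_iff₀ hlog, ← Real.log_rpow (by positivity),
    Real.log_lt_log_iff (by positivity) hdk] at hk
  rw [Real.norm_of_nonneg (by positivity), ← mul_neg, Real.rpow_mul (by positivity)]
  exact Real.rpow_le_rpow_of_nonpos (by positivity) hk.le (by simp)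

/-- Monotonicity gives `(k + 1) * d k ^ (-s) ≤ ∑ j ≤ k, d j ^ (-s) ≤ C`, so `d k` grows at least
like `(k + 1) ^ (1 / s)` up to a constant. -/
lemma inv_le_liminf_of_summable {d : ℕ → ℕ} (hd : ∀ k, 0 < d k) (hmono : Monotone d) {s : ℝ≥0}
    (h : Summable fun k => (d k : ℝ) ^ (-(s : ℝ))) :
    (s : ℝ≥0∞)⁻¹ ≤ liminf (fun k : ℕ =>
      ENNReal.ofReal (Real.log (d k : ℝ) / Real.log ((k : ℝ) + 1))) atTop := by
  have hd' : ∀ k, (0 : ℝ) < d k := fun k => by exact_mod_cast hd k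
  rcases eq_or_ne s 0 with rfl | hs
  · simp [summable_const_iff] at h
  have hs' : (0 : ℝ) < s := by exact_mod_cast pos_iff_ne_zero.2 hs
  set C := ∑' k, (d k : ℝ) ^ (-(s : ℝ)) with hC
  have hbd : ∀ k : ℕ, ((k : ℝ) + 1) * (d k : ℝ) ^ (-(s : ℝ)) ≤ C := fun k => by
    refine le_trans ?_ (h.sum_le_tsum (Finset.range (k + 1)) fun j _ => by positivity)
    have : ((k : ℝ) + 1) * (d k : ℝ) ^ (-(s : ℝ)) =
        ∑ _j ∈ Finset.range (k + 1), (d k : ℝ) ^ (-(s : ℝ)) := by simp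
    rw [this]
    refine Finset.sum_le_sum fun j hj => Real.rpow_le_rpow_of_nonpos (hd' j) ?_ (by linarith)
    exact_mod_cast hmono (by have := Finset.mem_range.1 hj; omega)
  have hCpos : 0 < C := lt_of_lt_of_le (by have := hd' 0; positivity) (hbd 0)
  refine ENNReal.le_of_forall_nnreal_lt fun b hb => ?_
  have hbs : (b : ℝ) * s < 1 := by
    rw [← one_div, ENNReal.lt_div_iff_mul_lt (Or.inl (by exact_mod_cast hs))
      (Or.inl ENNReal.coe_ne_top)] at hb
    exact_mod_cast hb
  refine le_liminf_of_le (by isBoundedDefault) ?_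
  have ht : Tendsto (fun k : ℕ => (1 - (b : ℝ) * s) * Real.log ((k : ℝ) + 1)) atTop atTop :=
    tendsto_log_natCast_add_one.const_mul_atTop (by linarith)
  filter_upwards [ht.eventually_ge_atTop (Real.log C),
    tendsto_log_natCast_add_one.eventually_gt_atTop 0] with k hk hlog
  rw [← ENNReal.ofReal_coe_nnreal]
  refine ENNReal.ofReal_le_ofReal ?_
  rw [le_div_iff₀ hlog]
  have h1 := Real.log_le_log (mul_pos (by positivity) (Real.rpow_pos_of_pos (hd' k) _)) (hbd k)
  rw [Real.log_mul (by positivity) (Real.rpow_pos_of_pos (hd' k) _).ne', Real.log_rpow (hd' k)] at h1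
  refine le_of_mul_le_mul_left ?_ hs'
  linarith

/-- The exponent of convergence of the Engel digits is the reciprocal of their logarithmic
rate. -/
lemma engelExponent_eq_inv {x : ℝ} (hx : x ∈ Ioo (0 : ℝ) 1) :
    engelExponent x = (engelLogRate x)⁻¹ := by
  by_cases h : ∃ k, engelMap^[k] x = 0
  · rw [engelExponent_eq_zero_of_eq_zero h, engelLogRate_eq_top_of_eq_zero h, ENNReal.inv_top]
  push Not at h
  have hx' : x ∈ Ico (0 : ℝ) 1 := ⟨hx.1.le, hx.2⟩
  have hd : ∀ k, 0 < engelDigit x k := fun k =>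
    (by omega : 0 < 2).trans_le (two_le_engelDigit hx' (h k))
  have hmono : Monotone (engelDigit x) := fun k l hkl => engelDigit_le_of_le hx' hkl (h l)
  rw [engelExponent_eq_of_ne_zero h, engelLogRate_eq_of_ne_zero h]
  refine le_antisymm ?_ ?_
  · refine le_of_forall_gt fun c hc => ?_
    obtain ⟨s, h1, h2⟩ := ENNReal.lt_iff_exists_nnreal_btwn.1 hc
    refine lt_of_le_of_lt (iInf₂_le s (summable_rpow_neg_of_lt_liminf hd ?_)) h2
    exact ENNReal.inv_lt_iff_inv_lt.1 h1
  · refine le_iInf₂ fun s hs => ?_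
    exact ENNReal.inv_le_iff_inv_le.1 (inv_le_liminf_of_summable hd hmono hs)

/-! ### The dimension formulas -/

lemma dimH_engelLogRate_le {β : ℝ≥0} (hβ : 1 ≤ β) :
    dimH {x : ℝ | x ∈ Ioo (0 : ℝ) 1 ∧ engelLogRate x ≤ β} ≤ 1 - (β : ℝ≥0∞)⁻¹ := by
  have hβ0 : β ≠ 0 := (zero_lt_one.trans_le hβ).ne'
  have hβ' : (0 : ℝ) < β := by exact_mod_cast pos_iff_ne_zero.2 hβ0
  refine le_of_forall_gt_imp_ge_of_dense fun c hc => ?_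
  have hlt : 1 - (β : ℝ≥0∞)⁻¹ < 1 :=
    ENNReal.sub_lt_self ENNReal.one_ne_top one_ne_zero (by simp)
  obtain ⟨s, h1, h2⟩ := ENNReal.lt_iff_exists_nnreal_btwn.1 (lt_min hc hlt)
  refine le_trans ?_ (h2.le.trans (min_le_left _ _))
  have hs0 : (0 : ℝ) < s := by exact_mod_cast (zero_le).trans_lt h1
  have hs1 : (s : ℝ) < 1 := by exact_mod_cast h2.trans_le (min_le_right _ _)
  have hβs : (β : ℝ) * (1 - s) < 1 := by
    rw [← ENNReal.coe_inv hβ0, ← ENNReal.coe_one, ← ENNReal.coe_sub, ENNReal.coe_lt_coe,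
      ← NNReal.coe_lt_coe, NNReal.coe_sub (inv_le_one_of_one_le₀ hβ)] at h1
    push_cast at h1
    have : (β : ℝ) * (1 - (β : ℝ)⁻¹) < β * s := by gcongr
    rw [mul_sub, mul_inv_cancel₀ hβ'.ne'] at this
    linarith
  -- `s > 1 - 1/β` leaves room for `β < τ < 1 / (1 - s)`.
  obtain ⟨τ, hτ1, hτ2⟩ := exists_between ((lt_div_iff₀ (by linarith : (0 : ℝ) < 1 - s)).2 hβs)
  have hzero := hausdorffMeasure_frequently_engelDigit_lt hs0 hs1
    ((lt_div_iff₀ (by linarith : (0 : ℝ) < 1 - s)).1 hτ2)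
  refine dimH_le_of_hausdorffMeasure_ne_top (ne_top_of_le_ne_top ENNReal.zero_ne_top ?_)
  rw [← hzero]
  refine measure_mono ?_
  rintro x ⟨hx, hD⟩
  have hne : ∀ k, engelMap^[k] x ≠ 0 := fun k hk => by
    rw [engelLogRate_eq_top_of_eq_zero ⟨k, hk⟩] at hD
    exact ENNReal.coe_ne_top (top_le_iff.1 hD)
  rw [engelLogRate_eq_of_ne_zero hne] at hD
  have hlt : (β : ℝ≥0∞) < ENNReal.ofReal τ := by
    rw [← ENNReal.ofReal_coe_nnreal]
    exact (ENNReal.ofReal_lt_ofReal_iff (hβ'.trans hτ1)).2 hτ1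
  refine ⟨hx, hne, ((frequently_lt_of_liminf_lt (by isBoundedDefault)
    (hD.trans_lt hlt)).and_eventually (tendsto_log_natCast_add_one.eventually_gt_atTop 0)).mono ?_⟩
  rintro k ⟨hk, hlog⟩
  have h2 := two_le_engelDigit ⟨hx.1.le, hx.2⟩ (hne k)
  have hd : (0 : ℝ) < engelDigit x k := by exact_mod_cast (by omega : 0 < 2).trans_le h2
  rw [ENNReal.ofReal_lt_ofReal_iff (hβ'.trans hτ1), div_lt_iff₀ hlog,
    ← Real.log_rpow (by positivity), Real.log_lt_log_iff hd (by positivity)] at hk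
  exact hk

lemma one_sub_inv_le_dimH_engelLogRate_eq {α : ℝ≥0∞} (hα : 1 ≤ α) :
    1 - α⁻¹ ≤ dimH {x : ℝ | x ∈ Ioo (0 : ℝ) 1 ∧ engelLogRate x = α} := by
  refine ENNReal.le_of_forall_nnreal_lt fun s hs => ?_
  rcases eq_or_ne s 0 with rfl | hs0
  · simp
  have hs0 : 0 < s := pos_iff_ne_zero.2 hs0
  induction α with
  | top => exact le_dimH_engelLogRate_eq_top hs0 (by simpa using hs)
  | coe β =>
    have hβ : 1 ≤ β := by exact_mod_cast hα
    have hβ0 : β ≠ 0 := (zero_lt_one.trans_le hβ).ne'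
    have hβ' : (0 : ℝ) < β := by exact_mod_cast pos_iff_ne_zero.2 hβ0
    rw [← ENNReal.coe_inv hβ0, ← ENNReal.coe_one, ← ENNReal.coe_sub, ENNReal.coe_lt_coe,
      ← NNReal.coe_lt_coe, NNReal.coe_sub (inv_le_one_of_one_le₀ hβ)] at hs
    push_cast at hs
    have h1 : (β : ℝ) * s < β * (1 - (β : ℝ)⁻¹) := by gcongr
    rw [mul_sub, mul_inv_cancel₀ hβ'.ne', mul_one] at h1
    have hs' : (0 : ℝ) < s := hs0
    -- A positive `s < 1 - 1/β` forces `β > 1`; for `β = 1` only `s = 0` arises.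
    have h2 : (1 : ℝ) < β := by have := mul_pos hβ' hs'; linarith
    have := le_dimH_engelLogRate_eq h2 hs0 h1
    rwa [ENNReal.ofReal_coe_nnreal] at this

lemma dimH_engelLogRate (α : ℝ≥0∞) :
    dimH {x : ℝ | x ∈ Ioo (0 : ℝ) 1 ∧ engelLogRate x = α} = 1 - α⁻¹ ∧
      dimH {x : ℝ | x ∈ Ioo (0 : ℝ) 1 ∧ engelLogRate x ≤ α} = 1 - α⁻¹ := by
  have hsub : dimH {x : ℝ | x ∈ Ioo (0 : ℝ) 1 ∧ engelLogRate x = α} ≤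
      dimH {x : ℝ | x ∈ Ioo (0 : ℝ) 1 ∧ engelLogRate x ≤ α} :=
    dimH_mono fun x hx => ⟨hx.1, hx.2.le⟩
  have hup : dimH {x : ℝ | x ∈ Ioo (0 : ℝ) 1 ∧ engelLogRate x ≤ α} ≤ 1 - α⁻¹ := by
    rcases le_total α 1 with hα | hα
    -- For `α ≤ 1` the set lies in the one for `α = 1`, whose dimension is already `0`.
    · have hle : {x : ℝ | x ∈ Ioo (0 : ℝ) 1 ∧ engelLogRate x ≤ α} ⊆
          {x : ℝ | x ∈ Ioo (0 : ℝ) 1 ∧ engelLogRate x ≤ (1 : ℝ≥0)} :=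
        fun x hx => ⟨hx.1, by exact_mod_cast hx.2.trans hα⟩
      refine (dimH_mono hle).trans ((dimH_engelLogRate_le le_rfl).trans ?_)
      simp
    · induction α with
      | top =>
        refine (dimH_mono (subset_univ _)).trans ?_
        rw [Real.dimH_univ]; simp
      | coe β => exact dimH_engelLogRate_le (by exact_mod_cast hα)
  have hlow : 1 - α⁻¹ ≤ dimH {x : ℝ | x ∈ Ioo (0 : ℝ) 1 ∧ engelLogRate x = α} := by
    rcases le_total α 1 with hα | hα
    · rw [tsub_eq_zero_of_le (ENNReal.one_le_inv.2 hα)]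
      exact zero_le
    · exact one_sub_inv_le_dimH_engelLogRate_eq hα
  exact ⟨le_antisymm (hsub.trans hup) hlow, le_antisymm hup (hlow.trans hsub)⟩

theorem mainTheorem1 :
    (∀ α : ℝ≥0∞,
      dimH {x : ℝ | x ∈ Set.Ioo (0 : ℝ) 1 ∧ engelExponent x = α} =
          (if α ≤ 1 then 1 - α else 0) ∧
        dimH {x : ℝ | x ∈ Set.Ioo (0 : ℝ) 1 ∧ α ≤ engelExponent x} =
          (if α ≤ 1 then 1 - α else 0)) ∧
    (∀ α : ℝ≥0∞,
      dimH {x : ℝ | x ∈ Set.Ioo (0 : ℝ) 1 ∧ engelLogRate x = α} =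
          (if α < 1 then 0 else if α = ⊤ then 1 else (α - 1) / α) ∧
        dimH {x : ℝ | x ∈ Set.Ioo (0 : ℝ) 1 ∧ engelLogRate x ≤ α} =
          (if α < 1 then 0 else if α = ⊤ then 1 else (α - 1) / α)) := by
  refine ⟨fun α => ?_, fun α => ?_⟩
  · have hval : (if α ≤ 1 then 1 - α else 0) = 1 - (α⁻¹)⁻¹ := by
      rw [inv_inv]
      split_ifs with h
      · rfl
      · exact (tsub_eq_zero_of_le (le_of_not_ge h)).symm
    have h1 : {x : ℝ | x ∈ Ioo (0 : ℝ) 1 ∧ engelExponent x = α} =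
        {x : ℝ | x ∈ Ioo (0 : ℝ) 1 ∧ engelLogRate x = α⁻¹} := by
      ext x
      refine and_congr_right fun hx => ?_
      rw [engelExponent_eq_inv hx, inv_eq_iff_eq_inv]
    have h2 : {x : ℝ | x ∈ Ioo (0 : ℝ) 1 ∧ α ≤ engelExponent x} =
        {x : ℝ | x ∈ Ioo (0 : ℝ) 1 ∧ engelLogRate x ≤ α⁻¹} := by
      ext x
      refine and_congr_right fun hx => ?_
      rw [engelExponent_eq_inv hx, ENNReal.le_inv_iff_le_inv]
    rw [hval, h1, h2]
    exact dimH_engelLogRate α⁻¹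
  · have hval : (if α < 1 then 0 else if α = ⊤ then 1 else (α - 1) / α) = 1 - α⁻¹ := by
      split_ifs with h h'
      · exact (tsub_eq_zero_of_le (ENNReal.one_le_inv.2 h.le)).symm
      · simp [h']
      · have h0 : α ≠ 0 := (zero_lt_one.trans_le (not_lt.1 h)).ne'
        rw [ENNReal.sub_div fun _ _ => h0, ENNReal.div_self h0 h', one_div]
    rw [hval]
    exact dimH_engelLogRate α
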